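/- A \emph{labelled tree} is a map $v:\{0,1\}^*\to\{0,1\}$; let $D$ be the set of all labelled trees, with the product topology. Let $$S=\{v\in D: v(x)=1 \text{ for exactly one } x\in\{0,1\}^*\},\qquad V=\{v\in D: \text{for every } \eta\in\{0,1\}^\omega \text{ only finitely many prefixes } x \text{ of } \eta \text{ have } v(x)=1\},$$ and let $\mathrm{Left}',\mathrm{Right}':D\to D$ be the shifts $\mathrm{Left}'(v)(x)=v(x0)$ and $\mathrm{Right}'(v)(x)=v(x1)$. A (nondeterministic) \emph{Rabin automaton} over a finite alphabet $A$ consists of a finite set $Q$ of states, an initial state $\iota$, a transition relation $\Delta\subseteq Q\times A\times Q\times Q$ and a family $\mathcal F\subseteq\mathcal P(Q)$. It accepts $v:\{0,1\}^*\to A$ if there is $r:\{0,1\}^*\to Q$ with $r(\lambda)=\iota$ ($\lambda$ the empty string) and $(r(x),v(x),r(x0),r(x1))\in\Delta$ for all $x$, such that for every infinite path the set of states that occur infinitely often on it belongs to $\mathcal F$. A (nondeterministic) \emph{Büchi automaton} over $A$ has instead a transition relation $\Delta\subseteq Q\times A\times Q$ and a set $F\subseteq Q$; it accepts $\alpha\in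 A^\omega$ if there is a sequence of states $q_0=\iota,q_1,\dots$ with $(q_i,\alpha(i),q_{i+1})\in\Delta$ for all $i$ in which some state of $F$ occurs infinitely often. A $k$-ary relation on $A$-labelled trees (on $A^\omega$) is Rabin (Büchi) recognizable if the set of its convolutions, which are trees (words) over the alphabet $A^k$, is the set of inputs accepted by some Rabin (Büchi) automaton. A structure is Rabin automatic, Büchi automatic, or Borel in a Polish space $X$, if its elements are $A$-labelled trees for a finite $A$, words in $A^\omega$ for a finite $A$, or points of $X$, respectively, and its domain, its basic relations and the graphs of its basic functions are Rabin recognizable, Büchi recognizable, or Borel sets, respectively. \textbf{Theorem} (Hjorth, Khoussainov, Montalbán, Nies; 2008). The structure $\mathcal A=(D;S,V,\mathrm{Left}',\mathrm{Right}')$ is Rabin automatic. It is not isomorphic to any Borel structure in $\{0,1\}^\omega$, nor to one in any other Polish space, and it is not isomorphic to any Büchi automatic structure. In particular, there is a Rabin automatic structure without a Borel presentation and hence without a Büchi automatic presentation. Moreover, there is a continuous map $f:\{0,1\}^{\omega^{<\omega}}\to D$ such that, for every $T\subseteq\omega^{<\omega}$ closed under prefixes (identified with its characteristic function), $f(T)\in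 V$ if and only if $T$ has no infinite path; and $V$ is not a Borel subset of $D$. -/

import Mathlib

open scoped FirstOrder

namespace AutStr

/-! ### Infinite words, infinite binary trees, convolutions -/

/-- Nodes of the full binary tree: finite binary strings (`false` is `0`, `true` is `1`). -/
abbrev Node : Type := List Bool

/-- The left successor appends `0`. -/
def Node.left (x : Node) : Node := x ++ [false]

/-- The right successor appends `1`. -/
def Node.right (x : Node) : Node := x ++ [true]

/-- The `A`-labelled full binary trees. -/
abbrev Tree (A : Type) : Type := Node → A

/-- The infinite words over `A`. -/
abbrev Word (A : Type) : Type := ℕ → A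

/-- The initial segment of length `n` of an infinite sequence. -/
def initSeg {A : Type} (η : ℕ → A) (n : ℕ) : List A := (List.range n).map η

/-- The convolution of a tuple of labellings of the same index set (`ℕ` for infinite words,
`Node` for trees). -/
def conv {I A : Type} {k : ℕ} (x : Fin k → I → A) : I → (Fin k → A) := fun p j => x j p

/-! ### Büchi automata on infinite words -/

/-- A (nondeterministic) Büchi automaton over the alphabet `A`. -/
structure BuchiAutomaton (A : Type) where
  State : Type
  finite_state : Finite State
  init : State
  trans : Set (State × A × State)
  acc : Set State

/-- Some run on `α` visits some accepting state infinitely often. -/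
def BuchiAutomaton.Accepts {A : Type} (M : BuchiAutomaton A) (α : Word A) : Prop :=
  ∃ r : ℕ → M.State, r 0 = M.init ∧ (∀ i, (r i, α i, r (i + 1)) ∈ M.trans) ∧
    ∃ s ∈ M.acc, {i | r i = s}.Infinite

/-- A relation on infinite words is Büchi recognizable if the set of convolutions of its tuples is
the language of some Büchi automaton. -/
def BuchiRecognizable (A : Type) (k : ℕ) (R : Set (Fin k → Word A)) : Prop :=
  ∃ M : BuchiAutomaton (Fin k → A), {α | M.Accepts α} = conv '' R

/-! ### Rabin automata on infinite trees -/

/-- A (nondeterministic) Rabin automaton over the alphabet `A`; the acceptance condition is a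
family of sets of states. -/
structure RabinAutomaton (A : Type) where
  State : Type
  finite_state : Finite State
  init : State
  trans : Set (State × A × State × State)
  acc : Set (Set State)

/-- The runs of a Rabin automaton on a labelled tree. -/
def RabinAutomaton.IsRun {A : Type} (M : RabinAutomaton A) (v : Tree A) (r : Node → M.State) :
    Prop :=
  r [] = M.init ∧ ∀ x : Node, (r x, v x, r (Node.left x), r (Node.right x)) ∈ M.trans

/-- The set of states that occur infinitely often on the path `η`. -/
def infStates {S : Type} (r : Node → S) (η : ℕ → Bool) : Set S :=
  {s | {n | r (initSeg η n) = s}.Infinite}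

/-- Some run on `v` satisfies the acceptance condition on every path. -/
def RabinAutomaton.Accepts {A : Type} (M : RabinAutomaton A) (v : Tree A) : Prop :=
  ∃ r : Node → M.State, M.IsRun v r ∧ ∀ η : ℕ → Bool, infStates r η ∈ M.acc

/-- A relation on labelled trees is Rabin recognizable if the set of convolutions of its tuples is
the language of some Rabin automaton. -/
def RabinRecognizable (A : Type) (k : ℕ) (R : Set (Fin k → Tree A)) : Prop :=
  ∃ M : RabinAutomaton (Fin k → A), {v | M.Accepts v} = conv '' R

/-! ### Borel relations -/

/-- A relation on a topological space is Borel if it is a Borel set in the product topology. -/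
def BorelRel (X : Type*) [TopologicalSpace X] (k : ℕ) (R : Set (Fin k → X)) : Prop :=
  @MeasurableSet (Fin k → X) (borel (Fin k → X)) R

/-! ### Structures whose domain, basic relations and basic functions belong to a given class -/

/-- Let the elements of the structure `M` be points of the space `X` by means of the inclusion `e`.
The domain, the basic relations and the graphs of the basic functions all belong to the class `C`
of relations on `X`. -/
def StructureIn {X M : Type*} (C : (k : ℕ) → Set (Fin k → X) → Prop)
    (L : FirstOrder.Language.{0, 0}) [L.Structure M] (e : M → X) : Prop :=
  C 1 {x | ∃ a : M, x = fun _ => e a} ∧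
  (∀ (n : ℕ) (R : L.Relations n),
    C n {x | ∃ a : Fin n → M, FirstOrder.Language.Structure.RelMap R a ∧ x = fun i => e (a i)}) ∧
  (∀ (n : ℕ) (f : L.Functions n),
    C (n + 1) {x | ∃ a : Fin n → M,
      x = Fin.snoc (α := fun _ => X) (fun i => e (a i)) (e (FirstOrder.Language.Structure.funMap f a))})

/-- `M` is isomorphic to a structure whose domain is a subset of `X` and whose domain, relations
and functions belong to the class `C`. -/
def HasPresentation {X : Type*} (C : (k : ℕ) → Set (Fin k → X) → Prop)
    (L : FirstOrder.Language.{0, 0}) (M : Type*) [L.Structure M] : Prop :=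
  ∃ (D : Set X) (_ : L.Structure D),
    StructureIn C L (Subtype.val : D → X) ∧ Nonempty (M ≃[L] D)

/-- A structure whose elements are all the `A`-labelled trees is Rabin automatic. -/
def IsRabinAutomatic (A : Type) (L : FirstOrder.Language.{0, 0}) [L.Structure (Tree A)] : Prop :=
  StructureIn (RabinRecognizable A) L (id : Tree A → Tree A)

/-- `M` is isomorphic to a Büchi automatic structure, over some finite alphabet. -/
def HasBuchiPresentation (L : FirstOrder.Language.{0, 0}) (M : Type*) [L.Structure M] : Prop :=
  ∃ (A : Type) (_ : Finite A), HasPresentation (BuchiRecognizable A) L M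

/-- `M` is isomorphic to a Borel structure with domain a Borel subset of `X`. -/
def HasBorelPresentation (X : Type*) [TopologicalSpace X] (L : FirstOrder.Language.{0, 0}) (M : Type*)
    [L.Structure M] : Prop :=
  HasPresentation (BorelRel X) L M

/-! ### The structure of `{0,1}`-labelled trees -/

/-- Exactly one node has label `1`. -/
def treeS : Set (Tree Bool) := {v | ∃! x : Node, v x = true}

/-- Every path has only finitely many nodes with label `1`. -/
def treeV : Set (Tree Bool) := {v | ∀ η : ℕ → Bool, {n | v (initSeg η n) = true}.Finite}

/-- The left shift: the label of `x` in the new tree is the old label of the left successor. -/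
def treeLeft (v : Tree Bool) : Tree Bool := fun x => v (Node.left x)

/-- The right shift: the label of `x` in the new tree is the old label of the right successor. -/
def treeRight (v : Tree Bool) : Tree Bool := fun x => v (Node.right x)

/-- Two unary function symbols. -/
inductive TreeFun : ℕ → Type
  | left : TreeFun 1
  | right : TreeFun 1

/-- Two unary relation symbols. -/
inductive TreeRel : ℕ → Type
  | S : TreeRel 1
  | V : TreeRel 1

/-- The language with unary predicates `S`, `V` and unary functions `Left'`, `Right'`. -/
def treeLang : FirstOrder.Language.{0, 0} := ⟨TreeFun, TreeRel⟩

/-- The structure on the set of all `{0,1}`-labelled trees. -/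
instance treeStructure : treeLang.Structure (Tree Bool) where
  funMap := fun {_} f =>
    match f with
    | TreeFun.left => fun a => treeLeft (a 0)
    | TreeFun.right => fun a => treeRight (a 0)
  RelMap := fun {_} R =>
    match R with
    | TreeRel.S => fun a => a 0 ∈ treeS
    | TreeRel.V => fun a => a 0 ∈ treeV

end AutStr

namespace AutStr

open Filter Topology MeasureTheory

/-! ### Initial segments -/

/-! The set of well-founded trees on `ℕ` is not analytic (`not_analyticSet_of_forall_mem_iff`, a
diagonal argument). Coding finite sequences by binary nodes so that prefixes correspond to prefixes
gives a continuous map `codeTree` with `codeTree T ∈ treeV` iff `T` is well-founded, so `treeV` is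
not Borel.

A presentation may carry a topology unrelated to that of the trees, so its isomorphism `Φ` can be
arbitrarily wild. But the label of `v` at `x` can be read off inside the structure. Applying the
shifts named by the letters of `x` gives `iterShift x v`, and if this equals the tree `rootTree`,
then `v x = 1`. Hence `T` is well-founded iff some element of the presented `V` has iterated shifts
that equal the fixed point `Φ rootTree` at the code of every `s` with `T s = true`. The family of
iterated shifts is a single point of a Polish space, subject to countably many analytic conditions.
If the presented `V` and the graphs of the shifts were analytic, so would be the set of well-founded
trees (`not_hasPresentation_of_analyticSet`). Borel sets and Büchi recognizable relations are
analytic, so both kinds of presentation are excluded.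

Rabin automaticity is shown by explicit automata for the two predicates and the two shifts. -/

@[simp] theorem initSeg_length {A : Type} (η : ℕ → A) (n : ℕ) : (initSeg η n).length = n := by
  simp [initSeg]

theorem initSeg_succ {A : Type} (η : ℕ → A) (n : ℕ) :
    initSeg η (n + 1) = initSeg η n ++ [η n] := by
  simp [initSeg, List.range_succ]

@[simp] theorem initSeg_getElem {A : Type} (η : ℕ → A) (n i : ℕ) (h : i < (initSeg η n).length) :
    (initSeg η n)[i] = η i := by
  simp [initSeg]

theorem initSeg_eq_iff {A : Type} (η ξ : ℕ → A) (n : ℕ) :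
    initSeg η n = initSeg ξ n ↔ ∀ i < n, η i = ξ i := by
  simp [initSeg]

theorem initSeg_eq_of_getElem {A : Type} (η : ℕ → A) (s : List A)
    (h : ∀ i (hi : i < s.length), s[i] = η i) : initSeg η s.length = s := by
  apply List.ext_getElem (by simp)
  intro i h1 h2
  simp [h i h2]

theorem initSeg_prefix {A : Type} (η : ℕ → A) {m n : ℕ} (h : m ≤ n) :
    initSeg η m <+: initSeg η n := by
  induction n, h using Nat.le_induction with
  | base => exact List.prefix_rfl
  | succ n _ ih => rw [initSeg_succ]; exact ih.trans (List.prefix_append _ _)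

theorem initSeg_take {A : Type} (η : ℕ → A) {m n : ℕ} (h : m ≤ n) :
    (initSeg η n).take m = initSeg η m := by
  have := List.prefix_iff_eq_take.1 (initSeg_prefix η h)
  rw [initSeg_length] at this
  exact this.symm

theorem eventually_initSeg_eq {A : Type} [TopologicalSpace A] [DiscreteTopology A] (η : ℕ → A)
    (n : ℕ) : ∀ᶠ ξ in 𝓝 η, initSeg ξ n = initSeg η n := by
  simp only [initSeg_eq_iff]
  refine (eventually_all_finite (Set.finite_Iio n)).2 fun i _ => ?_
  have h : Tendsto (fun ξ : ℕ → A => ξ i) (𝓝 η) (𝓝 (η i)) := (continuous_apply i).continuousAt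
  rw [nhds_discrete A, tendsto_pure] at h
  exact h

theorem polishSpace_of_discreteTopology (A : Type) [TopologicalSpace A] [DiscreteTopology A]
    [Countable A] : PolishSpace A := by
  obtain ⟨f, hf⟩ := exists_injective_nat A
  exact (IsClosedEmbedding.of_continuous_injective_isClosedMap continuous_of_discreteTopology hf
    fun s _ => isClosed_discrete _).polishSpace

instance polishSpace_bool : PolishSpace Bool := polishSpace_of_discreteTopology Bool

/-! ### Well-foundedness is not analytic -/

/-- `T` is closed under prefixes. -/
def PrefixClosed (T : List ℕ → Bool) : Prop :=
  ∀ s t : List ℕ, T (s ++ t) = true → T s = true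

/-- `T` has an infinite path. -/
def HasPath (T : List ℕ → Bool) : Prop :=
  ∃ α : ℕ → ℕ, ∀ n, T (initSeg α n) = true

/-- The section at `e` of the tree coded by `e`. -/
noncomputable def sectionTree (e : ℕ → Bool) (t : List ℕ) : Bool :=
  open Classical in
  decide (∀ m ≤ t.length, e (Encodable.encode (initSeg e m, t.take m)) = true)

/-- The set `P` in the diagonal argument is only controlled on prefix-closed trees; testing every `m
≤ t.length` in `sectionTree` secures this. -/
theorem prefixClosed_sectionTree (e : ℕ → Bool) : PrefixClosed (sectionTree e) := by
  intro s t h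
  simp only [sectionTree, decide_eq_true_eq] at h ⊢
  intro m hm
  have := h m (by simp; omega)
  rwa [List.take_append_of_le_length hm] at this

theorem hasPath_sectionTree_iff (e : ℕ → Bool) :
    HasPath (sectionTree e) ↔
      ∃ y : ℕ → ℕ, ∀ n, e (Encodable.encode (initSeg e n, initSeg y n)) = true := by
  refine exists_congr fun y => ?_
  simp only [sectionTree, decide_eq_true_eq, initSeg_length]
  constructor
  · intro h n
    have := h n n le_rfl
    rwa [initSeg_take y le_rfl] at this
  · intro h n m hm
    rw [initSeg_take y hm]
    exact h m

/-- Membership of `t` is decided by finitely many bits of `e`: the first `t.length` ones and those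
at the codes that they determine. -/
theorem continuous_sectionTree : Continuous sectionTree := by
  refine continuous_pi fun t => continuous_iff_continuousAt.2 fun e => ?_
  have h : ∀ᶠ e' in 𝓝 e, ∀ m ∈ Set.Iic t.length,
      e' (Encodable.encode (initSeg e' m, t.take m)) =
        e (Encodable.encode (initSeg e m, t.take m)) := by
    refine (eventually_all_finite (Set.finite_Iic _)).2 fun m _ => ?_
    have h : Tendsto (fun ξ : ℕ → Bool => ξ (Encodable.encode (initSeg e m, t.take m))) (𝓝 e)
      (𝓝 (e (Encodable.encode (initSeg e m, t.take m)))) := (continuous_apply _).continuousAt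
    rw [nhds_discrete Bool, tendsto_pure] at h
    filter_upwards [h, eventually_initSeg_eq e m] with e' h1 h2
    rw [h2, h1]
  refine tendsto_const_nhds.congr' ?_
  filter_upwards [h] with e' he'
  simp only [sectionTree]
  congr 1
  exact propext (forall₂_congr fun m hm => by rw [he' m hm])

/-- No analytic set separates the well-founded trees from the ill-founded ones. -/
theorem not_analyticSet_of_forall_mem_iff (P : Set (List ℕ → Bool)) (hP : AnalyticSet P)
    (h : ∀ T, PrefixClosed T → (T ∈ P ↔ ¬ HasPath T)) : False := by
  classical
  have hA : AnalyticSet (sectionTree ⁻¹' P) := hP.preimage continuous_sectionTree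
  have hmem : ∀ e, e ∈ sectionTree ⁻¹' P ↔
      ¬ ∃ y : ℕ → ℕ, ∀ n, e (Encodable.encode (initSeg e n, initSeg y n)) = true := fun e => by
    rw [← hasPath_sectionTree_iff]
    exact h _ (prefixClosed_sectionTree e)
  rw [AnalyticSet] at hA
  -- An empty preimage is impossible, since the constant `false` codes a tree without paths.
  -- Otherwise the preimage is the range of a continuous `g` on Baire space.
  obtain hA | ⟨g, hg, hgA⟩ := hA
  · have : (fun _ => false) ∈ sectionTree ⁻¹' P := (hmem _).2 (by simp)
    simp [hA] at this
  -- The tree of finite approximations to the graph of `g`, coded by the point `e`. Its section at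
  -- `e` has a path iff `e` is in the range of `g`, whereas membership in the preimage means that
  -- there is no path.
  let p : List Bool × List ℕ → Bool := fun q =>
    decide (∃ y, initSeg y q.2.length = q.2 ∧ initSeg (g y) q.1.length = q.1)
  let e : ℕ → Bool := fun k => ((Encodable.decode k).map p).getD false
  have he : ∀ q, e (Encodable.encode q) = p q := fun q => by simp only [e, Encodable.encodek, Option.map_some, Option.getD_some]
  have key : e ∈ sectionTree ⁻¹' P ↔
      ∃ y : ℕ → ℕ, ∀ n, e (Encodable.encode (initSeg e n, initSeg y n)) = true := by
    rw [← hgA]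
    refine exists_congr fun y => ?_
    simp only [he, p, initSeg_length, decide_eq_true_eq]
    constructor
    · intro hy n
      exact ⟨y, rfl, by rw [hy]⟩
    · intro hy
      -- Closedness of the graph: `z n` tends to `y` and `g (z n)` tends to `e`, so `g y = e`.
      choose z hz hgz using hy
      have hzt : Tendsto z atTop (𝓝 y) := by
        refine tendsto_pi_nhds.2 fun k => tendsto_const_nhds.congr' ?_
        filter_upwards [eventually_gt_atTop k] with n hn
        exact ((initSeg_eq_iff _ _ _).1 (hz n) k hn).symm
      have hgt := (hg.tendsto y).comp hzt
      funext k
      have hk := tendsto_pi_nhds.1 hgt k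
      rw [nhds_discrete, tendsto_pure] at hk
      obtain ⟨n, hn, hkn⟩ := (hk.and (eventually_gt_atTop k)).exists
      rw [← hn]
      exact (initSeg_eq_iff _ _ _).1 (hgz n) k hkn
  have := hmem e
  tauto

/-! ### Coding finite sequences of natural numbers by binary strings -/

/-- The block `0…01` coding a natural number. -/
def natBlock (n : ℕ) : List Bool := List.replicate (n + 1) false ++ [true]

/-- The code of a sequence: the marker `11`, which occurs nowhere else, followed by the blocks. -/
def seqCode (s : List ℕ) : Node := true :: true :: s.flatMap natBlock

/-- The blocks form a prefix code: the first `1` ends the block, and the zeros before it determine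
the number. -/
theorem natBlock_append_prefix {m n : ℕ} {x y : List Bool}
    (h : natBlock m ++ x <+: natBlock n ++ y) : m = n ∧ x <+: y := by
  induction m generalizing n with
  | zero =>
    cases n with
    | zero => simpa [natBlock] using h
    | succ n => simp [natBlock, List.replicate_succ, List.cons_prefix_cons] at h
  | succ m ih =>
    cases n with
    | zero => simp [natBlock, List.replicate_succ, List.cons_prefix_cons] at h
    | succ n =>
      have h' : natBlock m ++ x <+: natBlock n ++ y := by
        simpa [natBlock, List.replicate_succ, List.cons_prefix_cons] using h
      simpa using ih h'

theorem seqCode_prefix_iff {s t : List ℕ} : seqCode s <+: seqCode t ↔ s <+: t := by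
  simp only [seqCode, List.prefix_cons_inj]
  constructor
  · intro h
    induction s generalizing t with
    | nil => exact List.nil_prefix
    | cons m s ih =>
      cases t with
      | nil => simp [natBlock] at h
      | cons n t =>
        simp only [List.flatMap_cons] at h
        obtain ⟨rfl, h'⟩ := natBlock_append_prefix h
        exact (List.prefix_cons_inj _).2 (ih h')
  · rintro ⟨u, rfl⟩
    simp

theorem seqCode_injective : Function.Injective seqCode := fun _ _ h =>
  (seqCode_prefix_iff.1 (h ▸ List.prefix_rfl)).eq_of_length_le
    (seqCode_prefix_iff.1 (h ▸ List.prefix_rfl)).length_le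

theorem length_le_seqCode_length (s : List ℕ) : s.length ≤ (seqCode s).length := by
  induction s with
  | nil => simp
  | cons n s ih =>
    simp only [seqCode, List.flatMap_cons, List.length_cons, List.length_append] at ih ⊢
    have : 0 < (natBlock n).length := by simp [natBlock]
    omega

theorem seqCode_length_lt_of_append (s : List ℕ) (n : ℕ) :
    (seqCode s).length < (seqCode (s ++ [n])).length := by
  simp [seqCode, natBlock]

/-- Each block begins with `0`, even that of the number `0` because of the `n + 1` zeros, and its
only `1` is its last letter. So `11` never occurs in a concatenation of blocks. -/
theorem isChain_flatMap_natBlock (s : List ℕ) :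
    List.IsChain (fun a b : Bool => ¬ (a = true ∧ b = true)) (s.flatMap natBlock) ∧
      (s.flatMap natBlock).head? ≠ some true := by
  induction s with
  | nil => simp
  | cons n s ih =>
    refine ⟨?_, by simp [natBlock, List.replicate_succ]⟩
    rw [List.flatMap_cons, List.isChain_append]
    refine ⟨?_, ih.1, ?_⟩
    · rw [natBlock, List.isChain_append]
      refine ⟨?_, by simp, ?_⟩
      · exact List.isChain_replicate_of_rel _ (by simp)
      · intro a ha b _ hab
        have := List.eq_of_mem_replicate (List.mem_of_getLast? ha)
        exact Bool.false_ne_true (this.symm.trans hab.1)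
    · intro a _ b hb hab
      apply ih.2
      rw [← hab.2]
      exact hb

/-- No code is a proper suffix of another one. -/
theorem eq_nil_of_append_seqCode_eq {z : Node} {s t : List ℕ} (h : z ++ seqCode t = seqCode s) :
    z = [] := by
  by_contra hz
  obtain ⟨a, z, rfl⟩ := List.exists_cons_of_ne_nil hz
  -- If a letter precedes `seqCode t`, its marker `11` lies in `1` followed by blocks, where no two
  -- consecutive letters are `1`.
  have h1 : z ++ seqCode t = true :: s.flatMap natBlock := by
    simp only [seqCode, List.cons_append, List.cons.injEq] at h ⊢
    exact h.2
  have h2 : List.IsChain (fun a b : Bool => ¬ (a = true ∧ b = true))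
      (true :: s.flatMap natBlock) := by
    rw [List.isChain_cons]
    refine ⟨fun b hb hab => (isChain_flatMap_natBlock s).2 ?_, (isChain_flatMap_natBlock s).1⟩
    rw [← hab.2]
    exact hb
  rw [← h1, List.isChain_append] at h2
  have h3 := h2.2.1
  simp [seqCode] at h3

/-- The labelled tree whose label at the code of `s` is `T s`; all other labels are `0`. -/
noncomputable def codeTree (T : List ℕ → Bool) : Tree Bool := fun x =>
  open Classical in
  if h : ∃ s, seqCode s = x then T h.choose else false

theorem codeTree_eq_true_iff (T : List ℕ → Bool) (x : Node) :
    codeTree T x = true ↔ ∃ s, seqCode s = x ∧ T s = true := by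
  unfold codeTree
  split_ifs with h
  · constructor
    · exact fun h' => ⟨_, h.choose_spec, h'⟩
    · rintro ⟨s, hs, hT⟩
      rwa [seqCode_injective (h.choose_spec.trans hs.symm)]
  · simp only [false_iff]
    rintro ⟨s, hs, -⟩
    exact h ⟨s, hs⟩

theorem continuous_codeTree : Continuous codeTree := by
  refine continuous_pi fun x => ?_
  unfold codeTree
  split_ifs with h
  · exact continuous_apply _
  · exact continuous_const

/-- The codes of the initial segments of a path are labelled `1` and strictly extend one another, so
all lie on one binary path `η`. -/
theorem not_mem_treeV_of_hasPath {T : List ℕ → Bool} (h : HasPath T) : codeTree T ∉ treeV := by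
  obtain ⟨α, hα⟩ := h
  intro hV
  have hlen : ∀ k, k < (seqCode (initSeg α (k + 1))).length := fun k =>
    lt_of_lt_of_le (by simp) (length_le_seqCode_length _)
  let η : ℕ → Bool := fun k => (seqCode (initSeg α (k + 1)))[k]'(hlen k)
  have hη : ∀ n, initSeg η (seqCode (initSeg α n)).length = seqCode (initSeg α n) := by
    intro n
    apply initSeg_eq_of_getElem
    intro i hi
    rcases le_total n (i + 1) with hn | hn
    · exact (seqCode_prefix_iff.2 (initSeg_prefix α hn)).getElem hi
    · exact ((seqCode_prefix_iff.2 (initSeg_prefix α hn)).getElem (hlen i)).symm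
  have hmono : StrictMono fun n => (seqCode (initSeg α n)).length :=
    strictMono_nat_of_lt_succ fun n => by
      rw [initSeg_succ]
      exact seqCode_length_lt_of_append _ _
  refine Set.infinite_of_injective_forall_mem hmono.injective (fun n => ?_) (hV η)
  simp only [Set.mem_ofPred_eq]
  rw [hη, codeTree_eq_true_iff]
  exact ⟨_, rfl, hα n⟩

/-- Infinitely many labelled codes on one binary path are comparable nodes, so the coded sequences
form an infinite chain, whose union is a path. -/
theorem hasPath_of_codeTree_not_mem_treeV {T : List ℕ → Bool} (hT : PrefixClosed T)
    (h : codeTree T ∉ treeV) : HasPath T := by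
  simp only [treeV, Set.mem_ofPred_eq, not_forall] at h
  obtain ⟨η, hη⟩ := h
  let I : Set (List ℕ) := {s | T s = true ∧ seqCode s = initSeg η (seqCode s).length}
  have hcomp : ∀ s ∈ I, ∀ t ∈ I, s.length ≤ t.length → s <+: t := by
    rintro s ⟨-, hs⟩ t ⟨-, ht⟩ hst
    rcases le_total (seqCode s).length (seqCode t).length with h | h
    · rw [← seqCode_prefix_iff, hs, ht]
      exact initSeg_prefix η h
    · have : t <+: s := by
        rw [← seqCode_prefix_iff, hs, ht]
        exact initSeg_prefix η h
      rw [this.eq_of_length_le hst]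
  have hinf : I.Infinite := by
    intro hfin
    refine hη ((hfin.image fun s => (seqCode s).length).subset ?_)
    intro n hn
    obtain ⟨s, hs, hTs⟩ := (codeTree_eq_true_iff _ _).1 hn
    have hl : (seqCode s).length = n := by rw [hs, initSeg_length]
    exact ⟨s, ⟨hTs, by rw [hl, hs]⟩, hl⟩
  -- On a chain the length is injective, so infinitely many members have unbounded lengths.
  have hlong : ∀ n, ∃ s ∈ I, n < s.length := by
    intro n
    by_contra! hn
    refine hinf (Set.Finite.of_finite_image ((Set.finite_Iic n).subset ?_)
      (f := List.length) fun s hs t ht hst => ?_)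
    · rintro _ ⟨s, hs, rfl⟩
      exact hn s hs
    · exact (hcomp s hs t ht hst.le).eq_of_length hst
  choose s hsI hsn using hlong
  refine ⟨fun n => (s n)[n]'(hsn n), fun n => ?_⟩
  have : initSeg (fun n => (s n)[n]'(hsn n)) n = (s n).take n := by
    apply List.ext_getElem
    · simp [(hsn n).le]
    · intro i hi _
      rw [initSeg_length] at hi
      simp only [initSeg_getElem, List.getElem_take]
      rcases le_total (s i).length (s n).length with hl | hl
      · exact (hcomp _ (hsI i) _ (hsI n) hl).getElem (hsn i)
      · exact ((hcomp _ (hsI n) _ (hsI i) hl).getElem (hi.trans (hsn n))).symm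
  rw [this]
  apply hT _ ((s n).drop n)
  rw [List.take_append_drop]
  exact (hsI n).1

theorem codeTree_mem_treeV_iff {T : List ℕ → Bool} (hT : PrefixClosed T) :
    codeTree T ∈ treeV ↔ ¬ HasPath T :=
  ⟨fun h h' => not_mem_treeV_of_hasPath h' h,
    fun h => by_contra fun h' => h (hasPath_of_codeTree_not_mem_treeV hT h')⟩

theorem not_measurableSet_treeV : ¬ @MeasurableSet (Tree Bool) (borel (Tree Bool)) treeV := by
  intro h
  let : MeasurableSpace (Tree Bool) := borel (Tree Bool)
  have : BorelSpace (Tree Bool) := ⟨rfl⟩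
  exact not_analyticSet_of_forall_mem_iff _ (h.analyticSet.preimage continuous_codeTree)
    fun T hT => codeTree_mem_treeV_iff hT

/-! ### Analytic presentations -/

/-- The tree at the node `x`, after the shifts given by the letters of `x` from the last to the
first. -/
def iterShift (x : Node) (v : Tree Bool) : Tree Bool := fun y => v (y ++ x)

theorem iterShift_nil (v : Tree Bool) : iterShift [] v = v := by
  funext y
  simp [iterShift]

theorem treeLeft_iterShift (x : Node) (v : Tree Bool) :
    treeLeft (iterShift x v) = iterShift (false :: x) v := by
  funext y
  simp [treeLeft, iterShift, Node.left]

theorem treeRight_iterShift (x : Node) (v : Tree Bool) :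
    treeRight (iterShift x v) = iterShift (true :: x) v := by
  funext y
  simp [treeRight, iterShift, Node.right]

/-- The tree whose only label `1` is at the root. -/
def rootTree : Tree Bool := fun x => decide (x = [])

/-- The shifts append letters at the end of a node, so a label `1` of the shifted tree at `y` means
that `y ++ seqCode s` is a code; no code is a proper suffix of another, which forces `y` to be the
root. -/
theorem iterShift_seqCode_codeTree {T : List ℕ → Bool} {s : List ℕ} (hs : T s = true) :
    iterShift (seqCode s) (codeTree T) = rootTree := by
  funext y
  rw [Bool.eq_iff_iff, iterShift, codeTree_eq_true_iff, rootTree, decide_eq_true_eq]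
  constructor
  · rintro ⟨t, ht, -⟩
    exact eq_nil_of_append_seqCode_eq ht.symm
  · rintro rfl
    exact ⟨s, rfl, hs⟩

theorem apply_eq_true_of_iterShift_eq {x : Node} {v : Tree Bool}
    (h : iterShift x v = rootTree) : v x = true := by
  have := congrFun h []
  simpa [iterShift, rootTree] using this

/-- Thanks to this, a guessed tree need only dominate `codeTree T`; no condition has to enforce its
labels `0`. -/
theorem treeV_antitone {u v : Tree Bool} (huv : ∀ x, u x = true → v x = true) (hv : v ∈ treeV) :
    u ∈ treeV := fun η => (hv η).subset fun _ hn => huv _ hn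

/-- The structure of labelled trees is not isomorphic to a structure whose relations and graphs of
functions are analytic subsets of powers of a Polish space. -/
theorem not_hasPresentation_of_analyticSet {X : Type} [TopologicalSpace X] [PolishSpace X]
    (C : (k : ℕ) → Set (Fin k → X) → Prop) (hC : ∀ k R, C k R → AnalyticSet R) :
    ¬ HasPresentation C treeLang (Tree Bool) := by
  rintro ⟨D, _, ⟨-, hrel, hfun⟩, ⟨Φ⟩⟩
  have hV := hC _ _ (hrel 1 TreeRel.V)
  have hL := hC _ _ (hfun 1 TreeFun.left)
  have hR := hC _ _ (hfun 1 TreeFun.right)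
  have const_eq : ∀ a : Fin 1 → D, a = fun _ => a 0 := fun a => by
    funext i
    rw [Subsingleton.elim i 0]
  let VX := {x : Fin 1 → X | ∃ a : Fin 1 → D,
    FirstOrder.Language.Structure.RelMap (L := treeLang) (TreeRel.V : treeLang.Relations 1) a ∧
      x = fun i => (a i : X)}
  let graph : treeLang.Functions 1 → Set (Fin 2 → X) := fun f => {x | ∃ a : Fin 1 → D,
    x = Fin.snoc (α := fun _ => X) (fun i => (a i : X))
      (FirstOrder.Language.Structure.funMap f a : D)}
  replace hV : AnalyticSet VX := hV
  replace hL : AnalyticSet (graph TreeFun.left) := hL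
  replace hR : AnalyticSet (graph TreeFun.right) := hR
  have mapF : ∀ (f : treeLang.Functions 1) (v : Tree Bool),
      Φ (FirstOrder.Language.Structure.funMap f fun _ : Fin 1 => v) =
        FirstOrder.Language.Structure.funMap f (fun _ : Fin 1 => Φ v) := fun f v =>
    Φ.map_fun f (fun _ : Fin 1 => v)
  have mapV : ∀ v, FirstOrder.Language.Structure.RelMap (L := treeLang) (M := D)
      (TreeRel.V : treeLang.Relations 1) (fun _ : Fin 1 => Φ v) ↔ v ∈ treeV := fun v =>
    Φ.map_rel (TreeRel.V : treeLang.Relations 1) (fun _ : Fin 1 => v)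
  have memV : ∀ b : X, (fun _ => b) ∈ VX ↔ ∃ v, v ∈ treeV ∧ b = Φ v := fun b => by
    constructor
    · rintro ⟨a, ha, hb⟩
      obtain ⟨v, hv⟩ := Φ.surjective (a 0)
      rw [const_eq a, ← hv, mapV] at ha
      exact ⟨v, ha, by rw [hv]; exact congrFun hb 0⟩
    · rintro ⟨v, hv, rfl⟩
      exact ⟨_, (mapV v).2 hv, rfl⟩
  have memF : ∀ (f : treeLang.Functions 1) (b c : X), ![b, c] ∈ graph f ↔
      ∃ v, b = Φ v ∧ c = Φ (FirstOrder.Language.Structure.funMap f fun _ => v) := by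
    intro f b c
    constructor
    · rintro ⟨a, ha⟩
      obtain ⟨v, hv⟩ := Φ.surjective (a 0)
      rw [const_eq a, ← hv] at ha
      refine ⟨v, congrFun ha 0, ?_⟩
      rw [mapF]
      exact congrFun ha 1
    · rintro ⟨v, rfl, rfl⟩
      refine ⟨fun _ => Φ v, ?_⟩
      rw [mapF]
      funext i
      fin_cases i <;> rfl
  have memL : ∀ b c, ![b, c] ∈ graph TreeFun.left ↔ ∃ v, b = Φ v ∧ c = Φ (treeLeft v) :=
    memF TreeFun.left
  have memR : ∀ b c, ![b, c] ∈ graph TreeFun.right ↔ ∃ v, b = Φ v ∧ c = Φ (treeRight v) :=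
    memF TreeFun.right
  have inj : ∀ u v, ((Φ u : D) : X) = Φ v → u = v := fun u v h => Φ.injective (Subtype.ext h)
  -- A point of `Y` is a tree `T` with a guess, for each node `x`, of the image under `Φ` of
  -- `iterShift x v`. `E₁` puts the guess at the root into `V`, `E₂` and `E₃` link guesses by the
  -- shifts, and `E₄` forces a label `1` at the code of each `s` in `T`.
  let Y := (List ℕ → Bool) × (Node → X)
  let E₁ : Set Y := (fun p : Y => fun _ : Fin 1 => p.2 []) ⁻¹' VX
  let E₂ : Node → Set Y := fun x => (fun p : Y => ![p.2 x, p.2 (false :: x)]) ⁻¹' graph TreeFun.left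
  let E₃ : Node → Set Y := fun x => (fun p : Y => ![p.2 x, p.2 (true :: x)]) ⁻¹' graph TreeFun.right
  let E₄ : List ℕ → Set Y := fun s => {p | p.1 s = false} ∪ {p | p.2 (seqCode s) = Φ rootTree}
  let E : Option (List ℕ ⊕ Node ⊕ Node) → Set Y := fun i =>
    i.elim E₁ (Sum.elim E₄ (Sum.elim E₂ E₃))
  have cont : ∀ x, Continuous fun p : Y => p.2 x := fun x =>
    (continuous_apply x).comp continuous_snd
  have hE : ∀ i, AnalyticSet (E i) := by
    rintro (_ | s | x | x)
    · exact hV.preimage (continuous_pi fun _ => cont _)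
    · refine IsClosed.analyticSet (IsClosed.union ?_ ?_)
      · exact isClosed_eq ((continuous_apply s).comp continuous_fst) continuous_const
      · exact isClosed_eq (cont _) continuous_const
    · refine hL.preimage (continuous_pi fun i => ?_)
      fin_cases i
      · exact cont _
      · exact cont _
    · refine hR.preimage (continuous_pi fun i => ?_)
      fin_cases i
      · exact cont _
      · exact cont _
  refine not_analyticSet_of_forall_mem_iff _
    ((AnalyticSet.iInter hE).image_of_continuous continuous_fst) fun T hT => ?_
  rw [← codeTree_mem_treeV_iff hT]
  constructor
  · rintro ⟨⟨T', β⟩, hp, rfl⟩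
    rw [Set.mem_iInter] at hp
    obtain ⟨v, hv, hβ⟩ := (memV _).1 (hp none)
    -- The root guess determines all others, by induction on the node, since the graphs are those of
    -- functions and `Φ` is injective.
    have hβx : ∀ x, β x = Φ (iterShift x v) := by
      intro x
      induction x with
      | nil => rw [iterShift_nil]; exact hβ
      | cons a x ih =>
        cases a with
        | false =>
          obtain ⟨w, hw, hw'⟩ := (memL _ _).1 (hp (some (.inr (.inl x))))
          rw [← treeLeft_iterShift, inj _ _ (ih.symm.trans hw)]
          exact hw'
        | true =>
          obtain ⟨w, hw, hw'⟩ := (memR _ _).1 (hp (some (.inr (.inr x))))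
          rw [← treeRight_iterShift, inj _ _ (ih.symm.trans hw)]
          exact hw'
    refine treeV_antitone (fun x hx => ?_) hv
    obtain ⟨s, rfl, hs⟩ := (codeTree_eq_true_iff _ _).1 hx
    rcases hp (some (.inl s)) with h | h
    · exact absurd (hs.symm.trans h) (by simp)
    · exact apply_eq_true_of_iterShift_eq (inj _ _ ((hβx _).symm.trans h))
  · intro hv
    refine ⟨(T, fun x => Φ (iterShift x (codeTree T))), ?_, rfl⟩
    rw [Set.mem_iInter]
    rintro (_ | s | x | x)
    · exact (memV _).2 ⟨codeTree T, hv,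
        congrArg (fun v => ((Φ v : D) : X)) (iterShift_nil _)⟩
    · by_cases hs : T s = true
      · right
        simp only [Set.mem_ofPred_eq]
        rw [iterShift_seqCode_codeTree hs]
      · left
        simpa using hs
    · exact (memL _ _).2 ⟨_, rfl, by rw [treeLeft_iterShift]⟩
    · exact (memR _ _).2 ⟨_, rfl, by rw [treeRight_iterShift]⟩

theorem not_hasBorelPresentation (X : Type) [TopologicalSpace X] [PolishSpace X] :
    ¬ HasBorelPresentation X treeLang (Tree Bool) := by
  refine not_hasPresentation_of_analyticSet _ fun k R hR => ?_
  let : MeasurableSpace (Fin k → X) := borel (Fin k → X)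
  have : BorelSpace (Fin k → X) := ⟨rfl⟩
  exact MeasurableSet.analyticSet hR

/-! ### Büchi recognizable relations are analytic -/

theorem analyticSet_inter {X : Type*} [TopologicalSpace X] [T2Space X] {s t : Set X}
    (hs : AnalyticSet s) (ht : AnalyticSet t) : AnalyticSet (s ∩ t) := by
  rw [Set.inter_eq_iInter]
  exact AnalyticSet.iInter fun b => by cases b <;> assumption

/-- The language of a Büchi automaton is analytic. -/
theorem analyticSet_setOf_accepts {A : Type} [TopologicalSpace A] [DiscreteTopology A] [Finite A]
    (M : BuchiAutomaton A) : AnalyticSet {α | M.Accepts α} := by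
  have := M.finite_state
  let : TopologicalSpace M.State := ⊥
  have : DiscreteTopology M.State := ⟨rfl⟩
  have := polishSpace_of_discreteTopology A
  have := polishSpace_of_discreteTopology M.State
  let Y := (ℕ → A) × (ℕ → M.State)
  have cA : ∀ i, Continuous fun p : Y => p.1 i := fun i =>
    (continuous_apply i).comp continuous_fst
  have cS : ∀ i, Continuous fun p : Y => p.2 i := fun i =>
    (continuous_apply i).comp continuous_snd
  have hinf : ∀ s : M.State, AnalyticSet {p : Y | {i | p.2 i = s}.Infinite} := by
    intro s
    have : {p : Y | {i | p.2 i = s}.Infinite} = ⋂ n : ℕ, ⋃ i ∈ Set.Ici n, {p : Y | p.2 i = s} := by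
      ext p
      simp only [Set.mem_ofPred_eq, ← Nat.frequently_atTop_iff_infinite, frequently_atTop]
      simp
    rw [this]
    refine AnalyticSet.iInter fun n => ?_
    have ho : IsOpen (⋃ i ∈ Set.Ici n, {p : Y | p.2 i = s}) :=
      isOpen_biUnion fun i _ => (isOpen_discrete {s}).preimage (cS i)
    simpa using ho.analyticSet_image continuous_id
  -- The pairs of an input and an accepting run on it; the language is the projection to the inputs.
  have hE : AnalyticSet ({p : Y | p.2 0 = M.init} ∩
      ({p : Y | ∀ i, (p.2 i, p.1 i, p.2 (i + 1)) ∈ M.trans} ∩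
        ⋃ s : M.acc, {p : Y | {i | p.2 i = s}.Infinite})) := by
    have h1 : AnalyticSet {p : Y | p.2 0 = M.init} :=
      (isClosed_eq (cS 0) continuous_const).analyticSet
    have h2 : AnalyticSet {p : Y | ∀ i, (p.2 i, p.1 i, p.2 (i + 1)) ∈ M.trans} := by
      rw [Set.ofPred_forall]
      exact (isClosed_iInter fun i => (isClosed_discrete M.trans).preimage
        ((cS i).prodMk ((cA i).prodMk (cS (i + 1))))).analyticSet
    exact analyticSet_inter h1 (analyticSet_inter h2 (AnalyticSet.iUnion fun s => hinf s))
  convert hE.image_of_continuous continuous_fst using 1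
  ext α
  constructor
  · rintro ⟨r, h0, ht, s, hs, hi⟩
    exact ⟨(α, r), ⟨h0, ht, Set.mem_iUnion.2 ⟨⟨s, hs⟩, hi⟩⟩, rfl⟩
  · rintro ⟨⟨_, r⟩, ⟨h0, ht, h⟩, rfl⟩
    obtain ⟨⟨s, hs⟩, hi⟩ := Set.mem_iUnion.1 h
    exact ⟨r, h0, ht, s, hs, hi⟩

theorem not_hasBuchiPresentation : ¬ HasBuchiPresentation treeLang (Tree Bool) := by
  rintro ⟨A, _, h⟩
  let : TopologicalSpace A := ⊥
  have : DiscreteTopology A := ⟨rfl⟩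
  have := polishSpace_of_discreteTopology A
  refine not_hasPresentation_of_analyticSet _ (fun k R hR => ?_) h
  obtain ⟨M, hM⟩ := hR
  have hinj : Function.Injective (conv : (Fin k → ℕ → A) → ℕ → Fin k → A) := fun x y hxy => by
    funext j p
    exact congrFun (congrFun hxy p) j
  rw [← hinj.preimage_image R, ← hM]
  have := polishSpace_of_discreteTopology (Fin k → A)
  refine (analyticSet_setOf_accepts M).preimage ?_
  exact continuous_pi fun p => continuous_pi fun j =>
    (continuous_apply p).comp (continuous_apply j)

/-! ### Rabin automata for the basic relations -/

/-- Every tree over `Fin k → A` is a convolution, so acceptance need only be examined on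
convolutions. -/
theorem rabinRecognizable_of_accepts_iff {A : Type} {k : ℕ} {R : Set (Fin k → Tree A)}
    (M : RabinAutomaton (Fin k → A)) (h : ∀ x : Fin k → Tree A, M.Accepts (conv x) ↔ x ∈ R) :
    RabinRecognizable A k R := by
  refine ⟨M, Set.ext fun v => ⟨fun hv => ⟨fun j p => v p j, (h _).1 hv, rfl⟩, ?_⟩⟩
  rintro ⟨x, hx, rfl⟩
  exact (h x).2 hx

theorem rabinRecognizable_univ (A : Type) (k : ℕ) :
    RabinRecognizable A k (Set.univ : Set (Fin k → Tree A)) :=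
  rabinRecognizable_of_accepts_iff
    { State := Unit, finite_state := inferInstance, init := (), trans := Set.univ,
      acc := Set.univ }
    fun _ => ⟨fun _ => trivial, fun _ => ⟨fun _ => (), ⟨rfl, fun _ => trivial⟩, fun _ => trivial⟩⟩

/-- An automaton whose state is the label that the current node must have, if any. -/
def shiftAutomaton (b : Bool) : RabinAutomaton (Fin 2 → Bool) where
  State := Option Bool
  finite_state := inferInstance
  init := none
  trans := {q | (∀ c, q.1 = some c → q.2.1 0 = c) ∧
    (if b then q.2.2.2 else q.2.2.1) = some (q.2.1 1)  ∧
    (if b then q.2.2.1 else q.2.2.2) = none}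
  acc := Set.univ

theorem shiftAutomaton_accepts_iff (b : Bool) (x : Fin 2 → Tree Bool) :
    (shiftAutomaton b).Accepts (conv x) ↔ ∀ y, x 1 y = x 0 (y ++ [b]) := by
  constructor
  · rintro ⟨r, ⟨-, hr⟩, -⟩ y
    have h1 : r (y ++ [b]) = some (x 1 y) := by
      have := (hr y).2.1
      cases b <;> exact this
    exact ((hr (y ++ [b])).1 _ h1).symm
  · intro h
    let r : Node → Option Bool := fun y =>
      if y.getLast? = some b then some (x 1 y.dropLast) else none
    refine ⟨r, ⟨by simp [r, shiftAutomaton], fun y => ⟨fun c hc => ?_, ?_, ?_⟩⟩, fun _ => trivial⟩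
    · simp only [r] at hc
      split_ifs at hc with hy
      rw [← Option.some.inj hc, h]
      obtain ⟨z, rfl⟩ := List.getLast?_eq_some_iff.1 hy
      simp [conv]
    · cases b <;> simp [r, Node.left, Node.right, conv]
    · cases b <;> simp [r, Node.left, Node.right]

theorem rabinRecognizable_shift (b : Bool) :
    RabinRecognizable Bool 2 {x | ∀ y, x 1 y = x 0 (y ++ [b])} :=
  rabinRecognizable_of_accepts_iff _ (shiftAutomaton_accepts_iff b)

/-- An automaton whose state is the label of the parent of the current node. -/
def pathFiniteAutomaton : RabinAutomaton (Fin 1 → Bool) where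
  State := Bool
  finite_state := inferInstance
  init := false
  trans := {q | q.2.2.1 = q.2.1 0 ∧ q.2.2.2 = q.2.1 0}
  acc := {F | true ∉ F}

theorem pathFiniteAutomaton_accepts_iff (x : Fin 1 → Tree Bool) :
    pathFiniteAutomaton.Accepts (conv x) ↔ x 0 ∈ treeV := by
  have key : ∀ r : Node → Bool, pathFiniteAutomaton.IsRun (conv x) r →
      ∀ η, true ∉ infStates r η ↔ {n | x 0 (initSeg η n) = true}.Finite := by
    rintro r ⟨h0, hr⟩ η
    have hs : ∀ n, r (initSeg η (n + 1)) = x 0 (initSeg η n) := fun n => by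
      rw [initSeg_succ]
      cases η n
      · exact (hr (initSeg η n)).1
      · exact (hr (initSeg η n)).2
    -- States lag one node behind the labels, and the initial state `false` contributes nothing at
    -- `n = 0`.
    have himg : {n | r (initSeg η n) = true} = Nat.succ '' {n | x 0 (initSeg η n) = true} := by
      ext n
      cases n with
      | zero => simpa [initSeg, pathFiniteAutomaton] using h0
      | succ n => simp [hs]
    simp only [infStates, Set.mem_ofPred_eq, Set.not_infinite]
    rw [himg, Set.finite_image_iff Nat.succ_injective.injOn]
  constructor
  · rintro ⟨r, hr, hacc⟩ η
    exact (key r hr η).1 (hacc η)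
  · intro hx
    let r : Node → Bool := fun y => if y = [] then false else x 0 y.dropLast
    have hr : pathFiniteAutomaton.IsRun (conv x) r :=
      ⟨by simp [r, pathFiniteAutomaton], fun y =>
        ⟨by simp [r, Node.left, conv], by simp [r, Node.right, conv]⟩⟩
    exact ⟨r, hr, fun η => (key r hr η).2 (hx η)⟩

theorem rabinRecognizable_treeV : RabinRecognizable Bool 1 {x | x 0 ∈ treeV} :=
  rabinRecognizable_of_accepts_iff _ pathFiniteAutomaton_accepts_iff

/-- An automaton whose state tells whether the label `1` occurs at the current node or below it. -/
def singletonAutomaton : RabinAutomaton (Fin 1 → Bool) where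
  State := Bool
  finite_state := inferInstance
  init := true
  trans := {q | if q.1 = true ∧ q.2.1 0 = false then q.2.2.1 = !q.2.2.2 else
    q.1 = q.2.1 0 ∧ q.2.2.1 = false ∧ q.2.2.2 = false}
  acc := {F | true ∉ F}

theorem singletonAutomaton_accepts_iff (x : Fin 1 → Tree Bool) :
    singletonAutomaton.Accepts (conv x) ↔ ∃ r : Node → Bool, r [] = true ∧
      (∀ y, if r y = true ∧ x 0 y = false then r (y ++ [false]) = !r (y ++ [true]) else
        r y = x 0 y ∧ r (y ++ [false]) = false ∧ r (y ++ [true]) = false) ∧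
      ∀ η, {n | r (initSeg η n) = true}.Finite := by
  constructor
  · rintro ⟨r, ⟨h0, hr⟩, hacc⟩
    exact ⟨r, h0, hr, fun η => Set.not_infinite.1 (hacc η)⟩
  · rintro ⟨r, h0, hr, hacc⟩
    exact ⟨r, ⟨h0, hr⟩, fun η => Set.not_infinite.2 (hacc η)⟩

theorem singletonAutomaton_accepts_of_mem {x : Fin 1 → Tree Bool} (hx : x 0 ∈ treeS) :
    singletonAutomaton.Accepts (conv x) := by
  obtain ⟨z, hz, huniq⟩ := hx
  have hlab : ∀ y, x 0 y = true ↔ y = z := fun y => ⟨huniq y, fun h => h ▸ hz⟩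
  refine (singletonAutomaton_accepts_iff x).2
    ⟨fun y => decide (y <+: z), by simp, fun y => ?_, fun η => ?_⟩
  · simp only [decide_eq_true_eq, decide_eq_false_iff_not]
    split_ifs with h
    · obtain ⟨⟨u, rfl⟩, hy⟩ := h
      cases u with
      | nil =>
        rw [List.append_nil] at hz
        simp [hz] at hy
      | cons c u =>
        simp only [List.prefix_append_right_inj]
        cases c <;> simp
    · by_cases hyz : y = z
      · subst hyz
        rw [hz]
        refine ⟨by simp, fun h => ?_, fun h => ?_⟩ <;> simpa using h.length_le
      · have hy : x 0 y = false := by simpa [hyz] using hlab y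
        have hp : ¬ y <+: z := fun hp => h ⟨hp, hy⟩
        exact ⟨by simp [hy, hp], fun h' => hp ((List.prefix_append _ _).trans h'),
          fun h' => hp ((List.prefix_append _ _).trans h')⟩
  · refine (Set.finite_Iic z.length).subset fun n hn => ?_
    simpa using (of_decide_eq_true hn).length_le

/-- The nodes in state `true` form one branch from the root, with at most one node per level
(`level`), which stops exactly at a label `1`. Labels lie only on this branch, and nothing below its
end is labelled, so there is at most one. The acceptance condition forbids the branch to go on
forever, so there is one. -/
theorem mem_treeS_of_singletonAutomaton_accepts {x : Fin 1 → Tree Bool}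
    (hx : singletonAutomaton.Accepts (conv x)) : x 0 ∈ treeS := by
  obtain ⟨r, h0, hr, hacc⟩ := (singletonAutomaton_accepts_iff x).1 hx
  have branch : ∀ y, r y = true → x 0 y = false → r (y ++ [false]) = !r (y ++ [true]) := by
    intro y h1 h2
    have := hr y
    rwa [if_pos ⟨h1, h2⟩] at this
  have settled : ∀ y, ¬ (r y = true ∧ x 0 y = false) → r y = x 0 y ∧ ∀ b, r (y ++ [b]) = false := by
    intro y h
    have := hr y
    rw [if_neg h] at this
    exact ⟨this.1, fun b => by cases b; exacts [this.2.1, this.2.2]⟩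
  have lab : ∀ y, x 0 y = true → r y = true := fun y hy => by
    rw [(settled y (by simp [hy])).1, hy]
  have down : ∀ y z, r y = false → r (y ++ z) = false := by
    intro y z hy
    induction z using List.reverseRecOn with
    | nil => simpa using hy
    | append_singleton z b ih =>
      rw [← List.append_assoc]
      exact (settled _ (by simp [ih])).2 b
  have level : ∀ n y z, y.length = n → z.length = n → r y = true → r z = true → y = z := by
    intro n
    induction n with
    | zero =>
      intro y z hy hz _ _
      rw [List.length_eq_zero_iff.1 hy, List.length_eq_zero_iff.1 hz]
    | succ n ih =>
      intro y z hy hz hry hrz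
      obtain ⟨y, b, rfl⟩ := y.eq_nil_or_concat'.resolve_left (List.ne_nil_of_length_eq_add_one hy)
      obtain ⟨z, c, rfl⟩ := z.eq_nil_or_concat'.resolve_left (List.ne_nil_of_length_eq_add_one hz)
      have up : ∀ u d, r (u ++ [d]) = true → r u = true := fun u d h => by
        by_contra h'
        simp [down u [d] (by simpa using h')] at h
      obtain rfl := ih y z (by simpa using hy) (by simpa using hz) (up _ _ hry) (up _ _ hrz)
      by_cases hl : x 0 y = true
      · simp [(settled y (by simp [hl])).2 b] at hry
      · have := branch y (up _ _ hry) (by simpa using hl)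
        cases b <;> cases c
        · rfl
        · simp [hry, hrz] at this
        · simp [hry, hrz] at this
        · rfl
  have below : ∀ y z, x 0 y = true → x 0 z = true → y.length ≤ z.length → y = z := by
    intro y z hy hz hyz
    have htake : r (z.take y.length) = true := by
      by_contra h'
      have := down _ (z.drop y.length) (by simpa using h')
      rw [List.take_append_drop, lab z hz] at this
      simp at this
    have hyt := level y.length y (z.take y.length) rfl (by simpa using hyz) (lab y hy) htake
    have hz' : y ++ z.drop y.length = z := by
      nth_rewrite 1 [hyt]
      exact List.take_append_drop _ _
    cases hd : z.drop y.length with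
    | nil => simpa [hd] using hz'
    | cons b u =>
      rw [hd] at hz'
      have := down (y ++ [b]) u ((settled y (by simp [hy])).2 b)
      rw [List.append_assoc, List.singleton_append, hz', lab z hz] at this
      simp at this
  have ex : ∃ y, x 0 y = true := by
    by_contra! hno
    -- Without any label `1`, the state `true` is handed on at every node, so following it gives a
    -- path with `true` at all its nodes.
    have step : ∀ y : {y : Node // r y = true}, ∃ b, r (y.1 ++ [b]) = true := by
      rintro ⟨y, hy⟩
      have := branch y hy (by simpa using hno y)
      cases h : r (y ++ [true])
      · exact ⟨false, by simp [this, h]⟩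
      · exact ⟨true, h⟩
    choose d hd using step
    let p : ℕ → {y : Node // r y = true} := fun n =>
      Nat.rec ⟨[], h0⟩ (fun _ y => ⟨y.1 ++ [d y], hd y⟩) n
    have hp : ∀ n, initSeg (fun n => d (p n)) n = (p n).1 := by
      intro n
      induction n with
      | zero => rfl
      | succ n ih => rw [initSeg_succ, ih]
    have hfin := hacc fun n => d (p n)
    have : {n | r (initSeg (fun n => d (p n)) n) = true} = Set.univ :=
      Set.eq_univ_of_forall fun n => by
        simp only [Set.mem_ofPred_eq]
        rw [hp]
        exact (p n).2
    rw [this] at hfin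
    exact Set.infinite_univ hfin
  obtain ⟨y, hy⟩ := ex
  refine ⟨y, hy, fun z hz => ?_⟩
  rcases le_total y.length z.length with h | h
  · exact (below y z hy hz h).symm
  · exact below z y hz hy h

theorem rabinRecognizable_treeS : RabinRecognizable Bool 1 {x | x 0 ∈ treeS} :=
  rabinRecognizable_of_accepts_iff _ fun _ =>
    ⟨mem_treeS_of_singletonAutomaton_accepts, singletonAutomaton_accepts_of_mem⟩

/-! ### The four recognizable relations in the form required by `StructureIn` -/

theorem setOf_exists_eq_unary (P : Set (Tree Bool)) :
    {x : Fin 1 → Tree Bool | ∃ a : Fin 1 → Tree Bool, a 0 ∈ P ∧ x = fun i => id (a i)} =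
      {x | x 0 ∈ P} := by
  ext x
  constructor
  · rintro ⟨a, ha, rfl⟩
    exact ha
  · exact fun hx => ⟨x, hx, rfl⟩

theorem setOf_exists_eq_snoc (f : Tree Bool → Tree Bool) (b : Bool)
    (hf : ∀ v y, f v y = v (y ++ [b])) :
    {x : Fin (1 + 1) → Tree Bool | ∃ a : Fin 1 → Tree Bool,
      x = Fin.snoc (α := fun _ => Tree Bool) (fun i => id (a i)) (id (f (a 0)))} =
      {x | ∀ y, x 1 y = x 0 (y ++ [b])} := by
  ext x
  constructor
  · rintro ⟨a, rfl⟩ y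
    exact hf (a 0) y
  · intro hx
    refine ⟨fun _ => x 0, ?_⟩
    funext i
    fin_cases i
    · rfl
    · funext y
      exact (hx y).trans (hf (x 0) y).symm

theorem isRabinAutomatic_treeLang : IsRabinAutomatic Bool treeLang := by
  refine ⟨?_, fun n R => ?_, fun n f => ?_⟩
  · convert rabinRecognizable_univ Bool 1 using 1
    refine Set.eq_univ_of_forall fun x => ⟨x 0, ?_⟩
    funext i
    rw [Subsingleton.elim i 0]
    rfl
  · cases R
    · exact setOf_exists_eq_unary treeS ▸ rabinRecognizable_treeS
    · exact setOf_exists_eq_unary treeV ▸ rabinRecognizable_treeV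
  · cases f
    · exact setOf_exists_eq_snoc treeLeft false (fun _ _ => rfl) ▸ rabinRecognizable_shift false
    · exact setOf_exists_eq_snoc treeRight true (fun _ _ => rfl) ▸ rabinRecognizable_shift true

end AutStr

theorem mainTheorem7 :
    -- the structure of all labelled trees with `S`, `V`, `Left'`, `Right'` is Rabin automatic
    AutStr.IsRabinAutomatic Bool AutStr.treeLang ∧
    -- it has no Borel presentation, in Cantor space or in any other Polish space
    (∀ (X : Type) [TopologicalSpace X] [PolishSpace X],
      ¬ AutStr.HasBorelPresentation X AutStr.treeLang (AutStr.Tree Bool)) ∧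
    -- it has no Büchi automatic presentation
    ¬ AutStr.HasBuchiPresentation AutStr.treeLang (AutStr.Tree Bool) ∧
    -- well-foundedness of trees of finite sequences of natural numbers reduces continuously to `V`
    (∃ f : (List ℕ → Bool) → AutStr.Tree Bool, Continuous f ∧
      ∀ T : List ℕ → Bool, (∀ s t : List ℕ, T (s ++ t) = true → T s = true) →
        (f T ∈ AutStr.treeV ↔ ¬ ∃ α : ℕ → ℕ, ∀ n, T (AutStr.initSeg α n) = true)) ∧
    -- `V` is not Borel
    ¬ @MeasurableSet (AutStr.Tree Bool) (borel (AutStr.Tree Bool)) AutStr.treeV :=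
  ⟨AutStr.isRabinAutomatic_treeLang, fun X _ _ => AutStr.not_hasBorelPresentation X,
    AutStr.not_hasBuchiPresentation,
    ⟨AutStr.codeTree, AutStr.continuous_codeTree, fun _ hT => AutStr.codeTree_mem_treeV_iff hT⟩,
    AutStr.not_measurableSet_treeV⟩
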